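/- Let $T$ be a topological semigroup with a neutral element $e$, let $X$ be a compact Hausdorff space with its uniform structure $\mathscr{U}_X$, and let $T\times X\to X$, $(t,x)\mapsto tx$, be a semiflow, i.e. a jointly continuous map with $ex=x$ and $(ts)x=t(sx)$ for all $s,t\in T$, $x\in X$. A set $A\subseteq T$ is called syndetic if there is a compact set $K\subseteq T$ with $Kt\cap A\neq\emptyset$ for every $t\in T$. Suppose that: 1. $T$ is amenable: every semiflow $(T,Y)$ on a nonempty compact Hausdorff space $Y$ admits a Borel probability measure $\mu$ that is invariant, i.e. $\mu(t^{-1}B)=\mu(B)$ for all $t\in T$ and all Borel sets $B\subseteq Y$, where $t^{-1}B=\{y\in Y : ty\in B\}$; 2. $T$ is a right C-semigroup: for every $s\in T$ the set $T\setminus Ts$ is relatively compact in $T$; 3. $(T,X)$ is pointwise almost periodic: for every $x\in X$ and every neighborhood $V$ of $x$, the set $\{t\in T : tx\in V\}$ is syndetic; 4. $(T,X)$ is weakly almost periodic: for every $f\in C(X,\mathbb{R})$, the set $\{f_t : t\in T\}$, where $f_t(x)=f(tx)$, is relatively compact in $C(X,\mathbb{R})$ with the topology of pointwise convergence. Then $(T,X)$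 is uniformly almost periodic: for every $\varepsilon\in\mathscr{U}_X$ there is a syndetic set $A\subseteq T$ such that $(x,tx)\in\varepsilon$ for all $x\in X$ and all $t\in A$. -/

import Mathlib

/-!
A semiflow `(T, X)` is expressed through Mathlib's classes: `T` is a topological monoid
(`Monoid T`, `TopologicalSpace T`, `ContinuousMul T`), acting on the left on `X` (`MulAction T X`)
by a jointly continuous map `T × X → X` (`ContinuousSMul T X`).
-/

universe u v

namespace Semiflow

/-- `A ⊆ T` is syndetic: there is a compact `K ⊆ T` such that `K t ∩ A ≠ ∅` for each `t ∈ T`. -/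
def IsSyndetic {T : Type u} [Monoid T] [TopologicalSpace T] (A : Set T) : Prop :=
  ∃ K : Set T, IsCompact K ∧ ∀ t : T, ∃ k ∈ K, k * t ∈ A

/-- A point `x` is almost periodic: for each neighborhood `V` of `x`, the set of return times
`{t | t x ∈ V}` is syndetic. -/
def IsAlmostPeriodicPt (T : Type u) {X : Type v} [Monoid T] [TopologicalSpace T]
    [TopologicalSpace X] [MulAction T X] (x : X) : Prop :=
  ∀ V ∈ nhds x, IsSyndetic {t : T | t • x ∈ V}

/-- Every point of `X` is almost periodic. -/
def IsPointwiseAlmostPeriodic (T : Type u) (X : Type v) [Monoid T] [TopologicalSpace T]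
    [TopologicalSpace X] [MulAction T X] : Prop :=
  ∀ x : X, IsAlmostPeriodicPt T x

/-- For each entourage `ε` there is a syndetic `A ⊆ T` with `A x ⊆ ε[x]` for all `x`. -/
def IsUniformlyAlmostPeriodic (T : Type u) (X : Type v) [Monoid T] [TopologicalSpace T]
    [UniformSpace X] [MulAction T X] : Prop :=
  ∀ ε ∈ uniformity X, ∃ A : Set T, IsSyndetic A ∧ ∀ x : X, ∀ t ∈ A, (x, t • x) ∈ ε

/-- The topology of pointwise convergence on `C(X, ℝ)` (not Mathlib's default compact-open
topology): the one induced by the inclusion into the product space `X → ℝ`. -/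
abbrev pointwiseTopology (X : Type v) [TopologicalSpace X] : TopologicalSpace C(X, ℝ) :=
  TopologicalSpace.induced (fun f : C(X, ℝ) => (f : X → ℝ)) inferInstance

/-- The function `f_t : x ↦ f (t x)`. -/
def translate {T : Type u} {X : Type v} [Monoid T] [TopologicalSpace T] [TopologicalSpace X]
    [MulAction T X] [ContinuousSMul T X] (f : C(X, ℝ)) (t : T) : C(X, ℝ) where
  toFun x := f (t • x)
  continuous_toFun := f.continuous.comp (continuous_const_smul t)

/-- For each `f ∈ C(X, ℝ)`, the set `T f = {f_t | t ∈ T}` is relatively compact in `C(X, ℝ)` with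
the topology of pointwise convergence (its closure there is compact). -/
def IsWeaklyAlmostPeriodic (T : Type u) (X : Type v) [Monoid T] [TopologicalSpace T]
    [TopologicalSpace X] [MulAction T X] [ContinuousSMul T X] : Prop :=
  ∀ f : C(X, ℝ), @IsCompact C(X, ℝ) (pointwiseTopology X)
    (@closure C(X, ℝ) (pointwiseTopology X) (Set.range fun t : T => translate f t))

/-- `T` is a right C-semigroup: for each `s ∈ T`, the set `T \ T s` is relatively compact in `T`. -/
def IsRightCSemigroup (T : Type u) [Monoid T] [TopologicalSpace T] : Prop :=
  ∀ s : T, IsCompact (closure (Set.range fun t : T => t * s)ᶜ)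

/-- `T` is amenable: each semiflow `(T, Y)` on a nonempty compact Hausdorff space `Y` admits an
invariant Borel probability measure. The spaces `Y` range over the universe `v`. -/
def IsAmenable (T : Type u) [Monoid T] [TopologicalSpace T] : Prop :=
  ∀ (Y : Type v) [TopologicalSpace Y] [CompactSpace Y] [T2Space Y] [Nonempty Y]
    [MulAction T Y] [ContinuousSMul T Y] [MeasurableSpace Y] [BorelSpace Y],
    ∃ μ : MeasureTheory.Measure Y, MeasureTheory.IsProbabilityMeasure μ ∧
      ∀ (t : T) (B : Set Y), MeasurableSet B → μ ((fun y : Y => t • y) ⁻¹' B) = μ B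

end Semiflow

/-! Weak almost periodicity makes every element of the enveloping semigroup `E` continuous, so `E`
is a compact semitopological monoid. In a minimal closed left ideal `L`, each point of `X` is fixed
by some idempotent, by pointwise almost periodicity. An invariant measure on `L` forces any two
idempotents to have a common fixed point in `L`, and minimality then makes them equal. So `L` has a
single idempotent, which fixes every point and is therefore the identity: `E` is a group
(`exists_left_inverse`).

Invariance passes from `T` to `E` by dominated convergence, because pointwise limits in play are
limits of sequences (`exists_seq_tendsto_of_ultrafilter`). In the group `E`, a Baire category
argument makes each orbit `{f ∘ p}` norm totally bounded
(`totallyBounded_range_of_dist_mul_right_le`). Hence finitely many `k ∈ T` uniformly approximate all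
of `E`, in particular the inverse of each `t`, and then `k * t` is uniformly close to the identity.
-/

open Filter Topology MeasureTheory

/-! ### Pointwise compact families of continuous functions -/

section Factoring

variable {Y κ ι : Type*} [TopologicalSpace Y]

/-- The map into the product of the values of a family of functions, onto its range. -/
def ContinuousMap.jointEval (h : κ → C(Y, ℝ)) : C(Y, Set.range fun y k => h k y) where
  toFun y := ⟨fun k => h k y, y, rfl⟩
  continuous_toFun := (continuous_pi fun k => (h k).continuous).subtype_mk _

/-- `g` identifies all points which every member of the family `h` identifies. -/
def ContinuousMap.FactorsThroughFamily (h : κ → C(Y, ℝ)) (g : C(Y, ℝ)) : Prop :=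
  ∀ x y, (∀ k, h k x = h k y) → g x = g y

namespace ContinuousMap

theorem jointEval_surjective (h : κ → C(Y, ℝ)) : Function.Surjective (jointEval h) := by
  rintro ⟨_, y, rfl⟩
  exact ⟨y, rfl⟩

theorem FactorsThroughFamily.exists_comp_jointEval [CompactSpace Y] {h : κ → C(Y, ℝ)}
    {g : C(Y, ℝ)} (hg : FactorsThroughFamily h g) :
    ∃ g' : C(Set.range fun y k => h k y, ℝ), g'.comp (jointEval h) = g := by
  have hq : IsQuotientMap (jointEval h) :=
    (jointEval h).continuous.isClosedMap.isQuotientMap (jointEval h).continuous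
      (jointEval_surjective h)
  have hf : Function.FactorsThrough g (jointEval h) := fun x y hxy =>
    hg x y fun k => congrFun (Subtype.ext_iff.mp hxy) k
  exact ⟨IsQuotientMap.lift (f := jointEval h) hq g hf, IsQuotientMap.lift_comp hq g hf⟩

theorem isCompact_range_eval [CompactSpace Y] (h : κ → C(Y, ℝ)) :
    CompactSpace (Set.range fun y k => h k y) :=
  isCompact_iff_compactSpace.mp
    (isCompact_range (continuous_pi fun k => (h k).continuous))

/-- The functions factoring through a countable family form a norm separable set. -/
theorem isSeparable_factorsThroughFamily [CompactSpace Y] [Countable κ] (h : κ → C(Y, ℝ)) :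
    TopologicalSpace.IsSeparable {g | FactorsThroughFamily h g} := by
  have := isCompact_range_eval h
  -- The joint range is a compact subset of a countable power of `ℝ`, hence metrizable, so its space
  -- of continuous functions is separable.
  refine (((TopologicalSpace.IsSeparable.of_separableSpace
    (Set.univ : Set C(Set.range fun y k => h k y, ℝ))).image
    (ContinuousMap.continuous_precomp (jointEval h)))).mono ?_
  intro g hg
  obtain ⟨g', hg'⟩ := FactorsThroughFamily.exists_comp_jointEval hg
  exact ⟨g', trivial, hg'⟩

/-- The functions factoring through a countable family are determined on a sequence. -/
theorem exists_seq_determining [CompactSpace Y] [Nonempty Y] [Countable κ] (h : κ → C(Y, ℝ)) :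
    ∃ D : ℕ → Y, ∀ g g', FactorsThroughFamily h g → FactorsThroughFamily h g' →
      (∀ n, g (D n) = g' (D n)) → g = g' := by
  have : Nonempty (Set.range fun y k => h k y) := (Set.range_nonempty _).to_subtype
  choose D hD using fun n => jointEval_surjective h
    (TopologicalSpace.denseSeq (Set.range fun y k => h k y) n)
  refine ⟨D, fun g g' hg hg' hn => ?_⟩
  obtain ⟨k, rfl⟩ := FactorsThroughFamily.exists_comp_jointEval hg
  obtain ⟨k', rfl⟩ := FactorsThroughFamily.exists_comp_jointEval hg'
  have : k = k' := by
    refine DFunLike.coe_injective (Continuous.ext_on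
      (TopologicalSpace.denseRange_denseSeq (Set.range fun y k => h k y))
      k.continuous k'.continuous ?_)
    rintro _ ⟨n, rfl⟩
    simpa [hD] using hn n
  rw [this]

theorem factorsThroughFamily_of_tendsto {h : ι → C(Y, ℝ)} {I : Set ι} {l : Filter ι} [l.NeBot]
    (hl : ∀ᶠ i in l, i ∈ I) {g : C(Y, ℝ)} (hg : ∀ y, Tendsto (fun i => h i y) l (𝓝 (g y))) :
    FactorsThroughFamily (fun i : I => h i) g := by
  intro x y hxy
  refine tendsto_nhds_unique (hg x) ((hg y).congr' ?_)
  filter_upwards [hl] with i hi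
  exact (hxy ⟨i, hi⟩).symm

/-- Countable tightness: a pointwise limit can be approximated on all finite tuples from a
countable subfamily. -/
theorem exists_countable_approx [CompactSpace Y] (h : ι → C(Y, ℝ)) {l : Filter ι} [l.NeBot]
    {g : C(Y, ℝ)} (hg : ∀ y, Tendsto (fun i => h i y) l (𝓝 (g y))) :
    ∃ I : Set ι, I.Countable ∧ ∀ (n : ℕ) (y : Fin n → Y),
      ∃ i ∈ I, ∀ k, dist (h i (y k)) (g (y k)) < 1 / ((n : ℝ) + 1) := by
  have key : ∀ n : ℕ, ∃ s : Finset ι, ∀ y : Fin n → Y,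
      ∃ i ∈ s, ∀ k, dist (h i (y k)) (g (y k)) < 1 / ((n : ℝ) + 1) := by
    intro n
    obtain ⟨s, hs⟩ := isCompact_univ.elim_finite_subcover
      (fun i => {y : Fin n → Y | ∀ k, dist (h i (y k)) (g (y k)) < 1 / ((n : ℝ) + 1)})
      (fun i => by
        simp only [Set.ofPred_forall]
        exact isOpen_iInter_of_finite fun k => isOpen_lt (by fun_prop) continuous_const)
      (fun y _ => by
        have : ∀ᶠ i in l, ∀ k, dist (h i (y k)) (g (y k)) < 1 / ((n : ℝ) + 1) :=
          eventually_all.2 fun k => Metric.tendsto_nhds.1 (hg (y k)) _ (by positivity)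
        obtain ⟨i, hi⟩ := this.exists
        exact Set.mem_iUnion.2 ⟨i, hi⟩)
    refine ⟨s, fun y => ?_⟩
    simpa using hs (Set.mem_univ y)
  choose s hs using key
  refine ⟨⋃ n, (s n : Set ι), Set.countable_iUnion fun n => (s n).countable_toSet, ?_⟩
  intro n y
  obtain ⟨i, hi, h'⟩ := hs n y
  exact ⟨i, Set.mem_iUnion.2 ⟨n, hi⟩, h'⟩

/-- If every pointwise ultrafilter limit of a family is continuous, then each such limit is the
pointwise limit of a sequence from the family. -/
theorem exists_seq_tendsto_of_ultrafilter [CompactSpace Y] [Nonempty Y] (h : ι → C(Y, ℝ))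
    (hcomp : ∀ U : Ultrafilter ι, ∃ g : C(Y, ℝ), ∀ y, Tendsto (fun i => h i y) U (𝓝 (g y)))
    {l : Filter ι} [l.NeBot] {g : C(Y, ℝ)} (hg : ∀ y, Tendsto (fun i => h i y) l (𝓝 (g y))) :
    ∃ a : ℕ → ι, ∀ y, Tendsto (fun n => h (a n) y) atTop (𝓝 (g y)) := by
  obtain ⟨I, hI, happ⟩ := exists_countable_approx h hg
  have := hI.to_subtype
  have hgf : FactorsThroughFamily (fun i : I => h i) g := by
    intro x y hxy
    refine eq_of_forall_dist_le fun ε hε => ?_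
    obtain ⟨n, hn⟩ := exists_nat_one_div_lt (half_pos hε)
    -- Length `n + 2` leaves room for both `x` and `y`, and only sharpens the tolerance.
    obtain ⟨i, hi, hk⟩ := happ (n + 2) fun k => if k = 0 then x else y
    have hx := hk 0
    have hy := hk 1
    simp only [if_true, Fin.one_eq_zero_iff] at hx hy
    rw [if_neg (by omega)] at hy
    have hxy' : h i x = h i y := hxy ⟨i, hi⟩
    have hle : 1 / (((n + 2 : ℕ) : ℝ) + 1) ≤ 1 / ((n : ℝ) + 1) := by
      apply one_div_le_one_div_of_le (by positivity)
      push_cast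
      linarith
    have := dist_triangle_left (g x) (g y) (h i x)
    rw [← hxy'] at hy
    linarith
  obtain ⟨D, hD⟩ := exists_seq_determining fun i : I => h i
  choose a ha hak using fun n : ℕ => happ n fun k : Fin n => D k
  have hDlim : ∀ m, Tendsto (fun n => h (a n) (D m)) atTop (𝓝 (g (D m))) := by
    intro m
    rw [tendsto_iff_dist_tendsto_zero]
    refine squeeze_zero' (Eventually.of_forall fun _ => dist_nonneg) ?_
      tendsto_one_div_add_atTop_nhds_zero_nat
    filter_upwards [eventually_gt_atTop m] with n hn
    exact (hak n ⟨m, hn⟩).le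
  refine ⟨a, fun y => ?_⟩
  -- Each cluster function of the sequence is continuous, factors through the same countable family
  -- and agrees with `g` on `D`, so it is `g`.
  rw [tendsto_iff_ultrafilter]
  intro U hU
  obtain ⟨g', hg'⟩ := hcomp (U.map a)
  have hg'f : FactorsThroughFamily (fun i : I => h i) g' :=
    factorsThroughFamily_of_tendsto (l := (U.map a : Filter ι))
      (Ultrafilter.mem_map.2 (Filter.univ_mem' ha)) hg'
  have : g' = g := hD _ _ hg'f hgf fun n =>
    tendsto_nhds_unique (f := fun i => h (a i) (D n)) (l := (U : Filter ℕ))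
      (hg' (D n)) ((hDlim n).mono_left hU)
  rw [← this]
  exact hg' y

/-- A uniformly bounded family all of whose pointwise ultrafilter limits are continuous: constancy
of the integral passes to pointwise limits. -/
theorem integral_eq_of_tendsto_ultrafilter [CompactSpace Y] [Nonempty Y]
    [MeasurableSpace Y] [BorelSpace Y] (μ : Measure Y) [IsFiniteMeasure μ] (h : ι → C(Y, ℝ))
    {M : ℝ} (hM : ∀ i y, ‖h i y‖ ≤ M)
    (hcomp : ∀ U : Ultrafilter ι, ∃ g : C(Y, ℝ), ∀ y, Tendsto (fun i => h i y) U (𝓝 (g y)))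
    {c : ℝ} (hc : ∀ i, ∫ y, h i y ∂μ = c)
    {l : Filter ι} [l.NeBot] {g : C(Y, ℝ)} (hg : ∀ y, Tendsto (fun i => h i y) l (𝓝 (g y))) :
    ∫ y, g y ∂μ = c := by
  obtain ⟨a, ha⟩ := exists_seq_tendsto_of_ultrafilter h hcomp hg
  have := tendsto_integral_of_dominated_convergence (μ := μ) (F := fun n y => h (a n) y)
    (f := fun y => g y) (fun _ => M)
    (fun n => (h (a n)).continuous.aestronglyMeasurable) (integrable_const M)
    (fun n => Eventually.of_forall fun y => hM _ y) (Eventually.of_forall ha)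
  simp only [hc] at this
  exact tendsto_nhds_unique this tendsto_const_nhds |>.symm ▸ rfl

end ContinuousMap

end Factoring

/-! ### Closed left ideals -/

/-- A nonempty closed left ideal. -/
structure IsClosedLeftIdeal {E : Type*} [Mul E] [TopologicalSpace E] (L : Set E) : Prop where
  isClosed : IsClosed L
  nonempty : L.Nonempty
  mul_mem : ∀ q, ∀ p ∈ L, q * p ∈ L

theorem exists_minimal_isClosedLeftIdeal {E : Type*} [Monoid E] [TopologicalSpace E]
    [CompactSpace E] : ∃ L : Set E, Minimal IsClosedLeftIdeal L := by
  obtain ⟨L, -, hL⟩ := zorn_superset_nonempty {L : Set E | IsClosedLeftIdeal L} (by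
    intro c hcs hc hne
    refine ⟨⋂₀ c, ⟨isClosed_sInter fun t ht => (hcs ht).1, ?_, fun q p hp => ?_⟩,
      fun s hs => Set.sInter_subset_of_mem hs⟩
    · have := hne.to_subtype
      rw [Set.sInter_eq_iInter]
      exact IsCompact.nonempty_iInter_of_directed_nonempty_isCompact_isClosed
        ((↑) : c → Set E) (DirectedOn.directed_val (IsChain.directedOn hc.symm))
        (fun i => (hcs i.prop).2) (fun i => (hcs i.prop).1.isCompact) (fun i => (hcs i.prop).1)
    · exact Set.mem_sInter.2 fun t ht => (hcs ht).3 q p (Set.mem_sInter.1 hp t ht))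
    Set.univ ⟨isClosed_univ, ⟨1, trivial⟩, fun _ _ _ => trivial⟩
  exact ⟨L, hL⟩

/-! ### Compact semitopological monoids and groups -/

section SemitopologicalMonoid

variable {E : Type*} [Monoid E] [TopologicalSpace E] [CompactSpace E] [T2Space E]
  [SeparatelyContinuousMul E]

/-- A closed submonoid of a compact semitopological group is closed under inverses. -/
theorem Submonoid.exists_inverse_of_isClosed (hinv : ∀ p : E, ∃ q, q * p = 1) (G : Submonoid E)
    (hG : IsClosed (G : Set E)) {p : E} (hp : p ∈ G) : ∃ q ∈ G, q * p = 1 ∧ p * q = 1 := by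
  have hR : ∀ r : E, Continuous (· * r) := fun r => SeparatelyContinuousMul.continuous_mul_const
  -- The compact semigroup `G * p` contains an idempotent, and a left-invertible idempotent is `1`.
  obtain ⟨w, ⟨q, hq, rfl⟩, hw⟩ := exists_idempotent_in_compact_subsemigroup hR
    ((· * p) '' (G : Set E)) ⟨_, 1, G.one_mem, rfl⟩ (hG.isCompact.image (hR p)) (by
      rintro _ ⟨a, ha, rfl⟩ _ ⟨b, hb, rfl⟩
      exact ⟨a * p * b, G.mul_mem (G.mul_mem ha hp) hb, by simp only [mul_assoc]⟩)
  simp only at hw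
  obtain ⟨w', hw'⟩ := hinv (q * p)
  have hqp : q * p = 1 := by
    calc q * p = w' * (q * p) * (q * p) := by rw [hw', one_mul]
      _ = w' * ((q * p) * (q * p)) := mul_assoc _ _ _
      _ = 1 := by rw [hw, hw']
  obtain ⟨q', hq'⟩ := hinv q
  have : q' = p := by
    calc q' = q' * (q * p) := by rw [hqp, mul_one]
      _ = p := by rw [← mul_assoc, hq', one_mul]
  exact ⟨q, hq, hqp, this ▸ hq'⟩

/-- A pointwise continuous map from a compact semitopological group to `C(Y, ℝ)` for which right
translations are nonexpansive has a norm totally bounded range. -/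
theorem totallyBounded_range_of_dist_mul_right_le (hinv : ∀ p : E, ∃ q, q * p = 1)
    {Y : Type*} [TopologicalSpace Y] [CompactSpace Y] (F : E → C(Y, ℝ))
    (hF : ∀ y, Continuous fun p => F p y)
    (hd : ∀ p q r, dist (F (p * r)) (F (q * r)) ≤ dist (F p) (F q)) :
    TotallyBounded (Set.range F) := by
  by_contra hnot
  obtain ⟨ε, hε, hsep⟩ : ∃ ε > 0, ∃ a : ℕ → E, ∀ m n, m < n → ε ≤ dist (F (a m)) (F (a n)) := by
    rw [Metric.totallyBounded_iff] at hnot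
    push Not at hnot
    obtain ⟨ε, hε, h⟩ := hnot
    obtain ⟨a, -, ha⟩ := exists_seq_of_forall_finset_exists (fun _ : E => True)
      (fun p q => ε ≤ dist (F p) (F q)) fun s _ => by
        obtain ⟨_, ⟨q, rfl⟩, hq⟩ := Set.not_subset.1 (h (F '' s) (s.finite_toSet.image F))
        refine ⟨q, trivial, fun p hp => ?_⟩
        by_contra hlt
        refine hq (Set.mem_iUnion₂.2 ⟨F p, ⟨p, hp, rfl⟩, ?_⟩)
        rw [Metric.mem_ball, dist_comm]
        exact not_le.1 hlt
    exact ⟨ε, hε, a, ha⟩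
  obtain ⟨a, ha⟩ := hsep
  have hR : ∀ r : E, Continuous (· * r) := fun r => SeparatelyContinuousMul.continuous_mul_const
  -- Passing to the closed submonoid generated by the separated sequence makes the range of `F` norm
  -- separable, as Baire's theorem requires.
  set C : Submonoid E := MonoidHom.mrange (FreeMonoid.lift a) with hCdef
  have hC : (C : Set E).Countable := by
    have : Countable (FreeMonoid ℕ) := inferInstanceAs (Countable (List ℕ))
    exact Set.countable_range _
  have := hC.to_subtype
  set G : Submonoid E := C.topologicalClosure with hGdef
  have hG : IsClosed (G : Set E) := C.isClosed_topologicalClosure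
  have haG : ∀ n, a n ∈ G := fun n =>
    C.le_topologicalClosure ⟨FreeMonoid.of n, FreeMonoid.lift_eval_of a n⟩
  have hfac : ∀ p ∈ G,
      ContinuousMap.FactorsThroughFamily (fun c : (C : Set E) => F c) (F p) := by
    intro p hp x y hxy
    have hcl : IsClosed {p | F p x = F p y} := isClosed_eq (hF x) (hF y)
    exact closure_minimal (s := (C : Set E)) (fun c hc => hxy ⟨c, hc⟩) hcl hp
  obtain ⟨S, hS, hSdense⟩ :=
    ContinuousMap.isSeparable_factorsThroughFamily fun c : (C : Set E) => F c
  have := hS.to_subtype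
  have : CompactSpace G := isCompact_iff_compactSpace.mp hG.isCompact
  have hclosed : ∀ s : S, IsClosed {p : G | dist (F p) s ≤ ε / 3} := by
    intro s
    simp only [ContinuousMap.dist_le (div_pos hε three_pos).le, Set.ofPred_forall]
    exact isClosed_iInter fun y => isClosed_le
      (((hF y).comp continuous_subtype_val).dist continuous_const) continuous_const
  obtain ⟨s, hs⟩ := nonempty_interior_of_iUnion_of_closed hclosed (by
    refine Set.eq_univ_of_forall fun p => ?_
    obtain ⟨s, hsS, hs⟩ := Metric.mem_closure_iff.1 (hSdense (hfac p p.2)) (ε / 3) (by positivity)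
    exact Set.mem_iUnion.2 ⟨⟨s, hsS⟩, hs.le⟩)
  set V := interior {p : G | dist (F p) s ≤ ε / 3} with hV
  obtain ⟨v, hv⟩ := hs
  -- Since `G` is a group, right translates of `V` cover it. By pigeonhole two terms of the sequence
  -- are moved into `V` by the same `r`; undoing `r` leaves them within `2 * ε / 3`.
  obtain ⟨R, hRcov⟩ := isCompact_univ.elim_finite_subcover
    (fun r : G => (fun p : G => p * r) ⁻¹' V)
    (fun r => isOpen_interior.preimage
      (((hR r).comp continuous_subtype_val).subtype_mk _))
    (fun p _ => by
      obtain ⟨q, hq, -, hpq⟩ := G.exists_inverse_of_isClosed hinv hG p.2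
      refine Set.mem_iUnion.2 ⟨⟨q, hq⟩ * v, ?_⟩
      have : p * (⟨q, hq⟩ * v) = v := by
        rw [← mul_assoc]
        ext
        simp [hpq]
      simpa [this] using hv)
  have hsel : ∀ n, ∃ r : R, (⟨a n, haG n⟩ : G) * r ∈ V := by
    intro n
    simpa using hRcov (Set.mem_univ (⟨a n, haG n⟩ : G))
  choose r hr using hsel
  obtain ⟨m, n, hmn, hrmn⟩ := Finite.exists_ne_map_eq_of_infinite r
  have hclose : ∀ m n, r m = r n → dist (F (a m)) (F (a n)) < ε := by
    intro m n hrmn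
    obtain ⟨q, -, -, hq⟩ := G.exists_inverse_of_isClosed hinv hG (r n).1.2
    have hm : dist (F (a m * r n)) s ≤ ε / 3 := by
      have := interior_subset (hr m)
      rwa [hrmn] at this
    have hn : dist (F (a n * r n)) s ≤ ε / 3 := by
      have := interior_subset (hr n)
      exact this
    have := hd (a m * r n) (a n * r n) q
    rw [mul_assoc, hq, mul_one, mul_assoc, hq, mul_one] at this
    have := dist_triangle_right (F (a m * r n)) (F (a n * r n)) s
    linarith
  rcases lt_or_gt_of_ne hmn with h | h
  · exact (ha m n h).not_gt (hclose m n hrmn)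
  · exact (ha n m h).not_gt (hclose n m hrmn.symm)

theorem Minimal.image_mul_right_eq {L : Set E} (hL : Minimal IsClosedLeftIdeal L) {p : E}
    (hp : p ∈ L) : (· * p) '' L = L := by
  have hR : Continuous (· * p) := SeparatelyContinuousMul.continuous_mul_const
  refine hL.eq_of_subset ⟨hR.isClosedMap _ hL.prop.isClosed, hL.prop.nonempty.image _, ?_⟩ ?_
  · rintro q _ ⟨r, hr, rfl⟩
    exact ⟨q * r, hL.prop.mul_mem q r hr, mul_assoc _ _ _⟩
  · rintro _ ⟨r, -, rfl⟩
    exact hL.prop.mul_mem r p hp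

/-- Idempotents of a minimal left ideal are right identities. -/
theorem Minimal.mul_idempotent {L : Set E} (hL : Minimal IsClosedLeftIdeal L) {u z : E}
    (hu : u ∈ L) (huu : u * u = u) (hz : z ∈ L) : z * u = z := by
  rw [← hL.image_mul_right_eq hu] at hz
  obtain ⟨r, -, rfl⟩ := hz
  simp only [mul_assoc, huu]

/-- Distinct idempotents of a minimal left ideal have no common fixed point in it. -/
theorem Minimal.idempotent_eq_of_mul_eq {L : Set E} (hL : Minimal IsClosedLeftIdeal L)
    {u v p : E} (hu : u ∈ L) (huu : u * u = u) (hv : v ∈ L) (hp : p ∈ L)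
    (hup : u * p = p) (hvp : v * p = p) : u = v := by
  obtain ⟨q, hq, hqp⟩ : ∃ q ∈ L, q * p = u := by
    have := hu
    rwa [← hL.image_mul_right_eq hp] at this
  -- `p * q` is an idempotent, hence a right identity of `L`, and left multiplication by `u` and by
  -- `v` agree on it.
  have hpq : p * q ∈ L := hL.prop.mul_mem p q hq
  have hidem : p * q * (p * q) = p * q := by
    calc p * q * (p * q) = p * (q * p) * q := by simp only [mul_assoc]
      _ = p * q := by rw [hqp, hL.mul_idempotent hu huu hp]
  calc u = u * (p * q) := (hL.mul_idempotent hpq hidem hu).symm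
    _ = v * (p * q) := by rw [← mul_assoc, ← mul_assoc, hup, hvp]
    _ = v := hL.mul_idempotent hpq hidem hv

end SemitopologicalMonoid

/-! ### The uniformity of a compact space via real functions -/

section CompactUniform

variable {X : Type*} [UniformSpace X] [CompactSpace X] [T2Space X]

/-- Urysohn functions separate points, so evaluation embeds the compact space, and a compact space
has only one compatible uniformity. -/
theorem isUniformInducing_eval_continuousMap :
    IsUniformInducing fun (x : X) (f : C(X, ℝ)) => f x := by
  have hc : Continuous fun (x : X) (f : C(X, ℝ)) => f x := continuous_pi fun f => f.continuous
  have hi : Function.Injective fun (x : X) (f : C(X, ℝ)) => f x := by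
    intro x y hxy
    by_contra hne
    obtain ⟨f, hf0, hf1, -⟩ := exists_continuous_zero_one_of_isClosed
      (isClosed_singleton (x := x)) (isClosed_singleton (x := y)) (by simpa using hne)
    have h0 := hf0 rfl
    have h1 := hf1 rfl
    have := congrFun hxy f
    simp_all
  have hind := (hc.isClosedEmbedding hi).isInducing
  refine isUniformInducing_iff_uniformSpace.2 (unique_uniformity_of_compact ?_ rfl)
  rw [UniformSpace.toTopologicalSpace_comap]
  exact hind.eq_induced.symm

theorem tendsto_uniformity_iff_continuousMap {α : Type*} {l : Filter α} {φ : α → X × X} :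
    Tendsto φ l (uniformity X) ↔
      ∀ f : C(X, ℝ), Tendsto (fun a => (f (φ a).1, f (φ a).2)) l (uniformity ℝ) := by
  rw [← isUniformInducing_eval_continuousMap.comap_uniformity, tendsto_comap_iff, Pi.uniformity,
    tendsto_iInf]
  refine forall_congr' fun f => ?_
  rw [tendsto_comap_iff]
  rfl

end CompactUniform

/-! ### The enveloping semigroup -/

namespace Semiflow

variable (T : Type u) (X : Type v) [Monoid T] [TopologicalSpace X] [MulAction T X]

/-- The enveloping (Ellis) semigroup: the pointwise closure of `T` in the self-maps of `X`. -/
def EnvelopingSemigroup : Type v :=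
  {p : X → X // p ∈ closure (Set.range fun (t : T) (x : X) => t • x)}

namespace EnvelopingSemigroup

instance : TopologicalSpace (EnvelopingSemigroup T X) :=
  inferInstanceAs (TopologicalSpace (Subtype _))

instance [T2Space X] : T2Space (EnvelopingSemigroup T X) :=
  inferInstanceAs (T2Space (Subtype _))

instance [CompactSpace X] : CompactSpace (EnvelopingSemigroup T X) :=
  isCompact_iff_compactSpace.mp isClosed_closure.isCompact

instance : FunLike (EnvelopingSemigroup T X) X X where
  coe p := p.1
  coe_injective _ _ h := Subtype.ext h

variable {T X}

theorem continuous_eval (x : X) : Continuous fun p : EnvelopingSemigroup T X => p x :=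
  (continuous_apply x).comp continuous_subtype_val

theorem continuous_of_eval {Z : Type*} [TopologicalSpace Z] {φ : Z → EnvelopingSemigroup T X}
    (h : ∀ x, Continuous fun z => φ z x) : Continuous φ :=
  (continuous_pi h).subtype_mk _

variable [ContinuousConstSMul T X]

/-- Right composition is always pointwise continuous, whereas left composition is so for elements of
`T`; hence `q` is approximated first, under a fixed `t`, and `p` afterwards. -/
theorem comp_mem (p q : EnvelopingSemigroup T X) :
    (fun x => p (q x)) ∈ closure (Set.range fun (t : T) (x : X) => t • x) := by
  have hmaps : ∀ t : T, (fun x => t • q x) ∈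
      closure (Set.range fun (t : T) (x : X) => t • x) := by
    intro t
    have hc : Continuous fun (r : X → X) (x : X) => t • r x :=
      continuous_pi fun x => (continuous_apply x).const_smul t
    refine map_mem_closure hc q.2 ?_
    rintro _ ⟨s, rfl⟩
    exact ⟨t * s, funext fun x => mul_smul t s x⟩
  have hc : Continuous fun (r : X → X) (x : X) => r (q x) :=
    continuous_pi fun x => continuous_apply (q x)
  have := map_mem_closure (t := closure (Set.range fun (t : T) (x : X) => t • x)) hc p.2 (by
    rintro _ ⟨t, rfl⟩
    exact hmaps t)
  rwa [closure_closure] at this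

instance : Monoid (EnvelopingSemigroup T X) where
  mul p q := ⟨fun x => p (q x), comp_mem p q⟩
  mul_assoc _ _ _ := rfl
  one := ⟨id, subset_closure ⟨1, funext fun x => one_smul T x⟩⟩
  one_mul _ := rfl
  mul_one _ := rfl

theorem one_apply (x : X) : (1 : EnvelopingSemigroup T X) x = x := rfl

variable (T X) in
/-- The canonical homomorphism from `T`. -/
def of : T →* EnvelopingSemigroup T X where
  toFun t := ⟨fun x => t • x, subset_closure ⟨t, rfl⟩⟩
  map_one' := DFunLike.ext _ _ fun x => one_smul T x
  map_mul' s t := DFunLike.ext _ _ fun x => mul_smul s t x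

theorem of_apply (t : T) (x : X) : of T X t x = t • x := rfl

theorem denseRange_of : DenseRange (of T X) := by
  intro p
  refine closure_subtype.2 (closure_mono ?_ p.2)
  rintro _ ⟨t, rfl⟩
  exact ⟨of T X t, ⟨t, rfl⟩, rfl⟩

theorem separatelyContinuousMul (hc : ∀ p : EnvelopingSemigroup T X, Continuous p) :
    SeparatelyContinuousMul (EnvelopingSemigroup T X) where
  continuous_const_mul {p} := continuous_of_eval fun x => (hc p).comp (continuous_eval x)
  continuous_mul_const {p} := continuous_of_eval fun x => continuous_eval (p x)

end EnvelopingSemigroup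

end Semiflow

/-! ### The enveloping semigroup as a group, and uniform approximation -/

namespace Semiflow

variable {T : Type u} {X : Type v} [Monoid T] [TopologicalSpace T]
  [UniformSpace X] [CompactSpace X] [T2Space X] [MulAction T X] [ContinuousSMul T X]

namespace EnvelopingSemigroup

/-- In a weakly almost periodic semiflow the enveloping semigroup consists of continuous maps. -/
theorem continuous_of_isWeaklyAlmostPeriodic (hwap : IsWeaklyAlmostPeriodic T X)
    (p : EnvelopingSemigroup T X) : Continuous p := by
  have hc : ∀ f : C(X, ℝ), Continuous fun x => f (p x) := by
    intro f
    obtain ⟨U, hU, hUp⟩ := mem_closure_iff_ultrafilter.1 (denseRange_of p)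
    let : TopologicalSpace C(X, ℝ) := pointwiseTopology X
    have hlim : Tendsto (fun q : EnvelopingSemigroup T X => fun x => f (q x)) U
        (𝓝 fun x => f (p x)) := tendsto_pi_nhds.2 fun x =>
      ((f.continuous.comp (continuous_eval x)).tendsto p).mono_left hUp
    have hclos : (fun x => f (p x)) ∈ closure (Set.range fun t : T => (translate f t : X → ℝ)) := by
      refine mem_closure_of_tendsto hlim ?_
      filter_upwards [hU]
      rintro _ ⟨t, rfl⟩
      exact ⟨t, rfl⟩
    have hcont : Continuous fun g : C(X, ℝ) => (g : X → ℝ) := continuous_induced_dom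
    -- Compactness among continuous functions makes the image closed in `X → ℝ`, so pointwise limits
    -- of translates stay continuous.
    have hcl := ((hwap f).image hcont).isClosed
    obtain ⟨g, -, hg⟩ := closure_minimal (by
      rintro _ ⟨t, rfl⟩
      exact ⟨translate f t, subset_closure ⟨t, rfl⟩, rfl⟩) hcl hclos
    have hg' : (g : X → ℝ) = fun x => f (p x) := hg
    rw [← hg']
    exact g.continuous
  exact isUniformInducing_eval_continuousMap.isInducing.continuous_iff.2 (continuous_pi hc)

/-- If `T` is amenable and its enveloping semigroup consists of continuous maps, any two idempotents
of the enveloping semigroup have a common fixed point in each closed left ideal. -/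
theorem exists_common_fixed_of_isAmenable (hamen : IsAmenable.{u, v} T)
    (hc : ∀ p : EnvelopingSemigroup T X, Continuous p) {L : Set (EnvelopingSemigroup T X)}
    (hL : IsClosedLeftIdeal L) {u v : EnvelopingSemigroup T X} (hu : u * u = u) (hv : v * v = v) :
    ∃ p ∈ L, u * p = p ∧ v * p = p := by
  have := separatelyContinuousMul hc
  by_contra hnot
  push Not at hnot
  have : CompactSpace L := isCompact_iff_compactSpace.mp hL.isClosed.isCompact
  have : Nonempty L := hL.nonempty.to_subtype
  let : MulAction T L :=
    { smul t p := ⟨of T X t * p, hL.mul_mem _ _ p.2⟩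
      one_smul p := Subtype.ext (by
        change of T X 1 * (p : EnvelopingSemigroup T X) = p
        rw [map_one, one_mul])
      mul_smul s t p := Subtype.ext (by
        change of T X (s * t) * (p : EnvelopingSemigroup T X) = of T X s * (of T X t * p)
        rw [map_mul, mul_assoc]) }
  have : ContinuousSMul T L := ⟨by
    refine Continuous.subtype_mk (continuous_of_eval fun x => ?_) _
    exact continuous_fst.smul
      ((continuous_eval x).comp (continuous_subtype_val.comp continuous_snd))⟩
  let : MeasurableSpace L := borel L
  have : BorelSpace L := ⟨rfl⟩
  obtain ⟨μ, hμ, hinv⟩ := hamen L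
  have hmul : ∀ q : EnvelopingSemigroup T X,
      Continuous fun p : L => (⟨q * p, hL.mul_mem _ _ p.2⟩ : L) := fun q =>
    ((SeparatelyContinuousMul.continuous_const_mul (a := q)).comp
      continuous_subtype_val).subtype_mk _
  -- Invariance of `μ` extends from `T` to its pointwise limits.
  have hint : ∀ (f : C(L, ℝ)) (q : EnvelopingSemigroup T X),
      ∫ p, f ⟨q * p, hL.mul_mem _ _ p.2⟩ ∂μ = ∫ p, f p ∂μ := by
    intro f q
    set h : EnvelopingSemigroup T X → C(L, ℝ) := fun q => f.comp ⟨_, hmul q⟩ with hh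
    have hpt : ∀ p : L, Continuous fun q => h q p := fun p =>
      f.continuous.comp (Continuous.subtype_mk
        (SeparatelyContinuousMul.continuous_mul_const (a := (p : EnvelopingSemigroup T X))) _)
    obtain ⟨U, hU, hUq⟩ := mem_closure_iff_ultrafilter.1 (denseRange_of q)
    have hne : (comap (of T X) (U : Filter (EnvelopingSemigroup T X))).NeBot :=
      comap_neBot_iff.2 fun s hs => by
        obtain ⟨_, hs', ⟨t, rfl⟩⟩ := U.neBot.nonempty_of_mem (inter_mem hs hU)
        exact ⟨t, hs'⟩
    refine ContinuousMap.integral_eq_of_tendsto_ultrafilter μ (fun t => h (of T X t))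
      (M := ‖f‖) (fun t p => f.norm_coe_le_norm _) (fun V => ?_) (fun t => ?_)
      (l := comap (of T X) U) (g := h q) fun p => ?_
    · refine ⟨h (V.map (of T X)).lim, fun p => ?_⟩
      exact ((hpt p).tendsto _).comp (V.map (of T X)).le_nhds_lim
    · have hmap : μ.map (fun p : L => t • p) = μ := by
        have hmeas : Measurable fun p : L => t • p := (continuous_const_smul t).measurable
        ext B hB
        rw [Measure.map_apply hmeas hB, hinv t B hB]
      calc ∫ p, f (t • p) ∂μ = ∫ p, f p ∂(μ.map fun p : L => t • p) :=
            (integral_map (continuous_const_smul t).measurable.aemeasurable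
              f.continuous.aestronglyMeasurable).symm
        _ = ∫ p, f p ∂μ := by rw [hmap]
    · exact ((hpt p).tendsto q).comp (tendsto_comap.mono_right hUq)
  have hclosed : ∀ q : EnvelopingSemigroup T X, IsClosed {p : L | q * p = p} := fun q =>
    isClosed_eq (continuous_subtype_val.comp (hmul q)) continuous_subtype_val
  -- Since `u * p` is fixed by `u` and `v * p` by `v`, a function separating the two fixed sets
  -- would have integral both `0` and `1`.
  obtain ⟨f, hf0, hf1, -⟩ := exists_continuous_zero_one_of_isClosed (hclosed u) (hclosed v)
    (Set.disjoint_left.2 fun p hup hvp => hnot p p.2 hup hvp)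
  have h0 : ∫ p, f ⟨u * p, hL.mul_mem _ _ p.2⟩ ∂μ = 0 := by
    have : ∀ p : L, f ⟨u * p, hL.mul_mem _ _ p.2⟩ = 0 := fun p =>
      hf0 (show u * (u * p) = u * p by rw [← mul_assoc, hu])
    simp [this]
  have h1 : ∫ p, f ⟨v * p, hL.mul_mem _ _ p.2⟩ ∂μ = 1 := by
    have : ∀ p : L, f ⟨v * p, hL.mul_mem _ _ p.2⟩ = 1 := fun p =>
      hf1 (show v * (v * p) = v * p by rw [← mul_assoc, hv])
    simp [this]
  rw [hint] at h0 h1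
  exact zero_ne_one (h0.symm.trans h1)

/-- In a closed left ideal of the enveloping semigroup, each almost periodic point is fixed by an
idempotent. -/
theorem exists_idempotent_apply_eq (hc : ∀ p : EnvelopingSemigroup T X, Continuous p)
    {L : Set (EnvelopingSemigroup T X)} (hL : IsClosedLeftIdeal L) {x : X}
    (hx : IsAlmostPeriodicPt T x) : ∃ u ∈ L, u * u = u ∧ u x = x := by
  have := separatelyContinuousMul hc
  obtain ⟨p, hp⟩ := hL.nonempty
  have hcl : IsClosed ((fun q : EnvelopingSemigroup T X => q x) '' L) :=
    (hL.isClosed.isCompact.image (continuous_eval x)).isClosed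
  have hmem : x ∈ (fun q : EnvelopingSemigroup T X => q x) '' L := by
    rw [← hcl.closure_eq, mem_closure_iff_nhds]
    intro W hW
    obtain ⟨V, hV, hVc, hVW⟩ : ∃ V ∈ 𝓝 x, IsClosed V ∧ V ⊆ W := exists_mem_nhds_isClosed_subset hW
    obtain ⟨K, hK, hKV⟩ := hx V hV
    -- Projection along the compact `K` is a closed map, so the return property passes from the
    -- orbit of `x` to every `q x`.
    have hclosed : IsClosed {y : X | ∃ k ∈ K, k • y ∈ V} := by
      have : CompactSpace K := isCompact_iff_compactSpace.mp hK
      have hcont : Continuous fun z : K × X => (z.1 : T) • z.2 :=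
        (continuous_subtype_val.comp continuous_fst).smul continuous_snd
      convert isClosedMap_snd_of_compactSpace _ (hVc.preimage hcont) using 1
      ext y
      simp
    have hall : ∀ q : EnvelopingSemigroup T X, q x ∈ {y : X | ∃ k ∈ K, k • y ∈ V} := by
      intro q
      refine denseRange_of.induction_on q (hclosed.preimage (continuous_eval x)) fun t => ?_
      obtain ⟨k, hk, hkt⟩ := hKV t
      exact ⟨k, hk, by rwa [of_apply, ← mul_smul]⟩
    obtain ⟨k, -, hkV⟩ := hall p
    exact ⟨k • p x, hVW hkV, of T X k * p, hL.mul_mem _ _ hp, rfl⟩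
  obtain ⟨q, hq, hqx⟩ := hmem
  obtain ⟨u, ⟨huL, hux⟩, huu⟩ := exists_idempotent_in_compact_subsemigroup
    (fun r : EnvelopingSemigroup T X => SeparatelyContinuousMul.continuous_mul_const)
    (L ∩ {q | q x = x}) ⟨q, hq, hqx⟩
    (hL.isClosed.inter (isClosed_singleton.preimage (continuous_eval x))).isCompact (by
      rintro a ⟨ha, hax⟩ b ⟨hb, hbx⟩
      refine ⟨hL.mul_mem a b hb, ?_⟩
      change a (b x) = x
      rw [show b x = x from hbx, show a x = x from hax])
  exact ⟨u, huL, huu, hux⟩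

/-- The enveloping semigroup of a pointwise almost periodic, weakly almost periodic action of an
amenable monoid is a group. -/
theorem exists_left_inverse (hamen : IsAmenable.{u, v} T)
    (hc : ∀ p : EnvelopingSemigroup T X, Continuous p) (hpap : IsPointwiseAlmostPeriodic T X)
    (p : EnvelopingSemigroup T X) : ∃ q, q * p = 1 := by
  have := separatelyContinuousMul hc
  obtain ⟨L, hL⟩ := exists_minimal_isClosedLeftIdeal (E := EnvelopingSemigroup T X)
  have hone : (1 : EnvelopingSemigroup T X) ∈ L := by
    obtain ⟨u, huL, huu⟩ := exists_idempotent_in_compact_subsemigroup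
      (fun r : EnvelopingSemigroup T X => SeparatelyContinuousMul.continuous_mul_const)
      L hL.prop.nonempty hL.prop.isClosed.isCompact fun a _ b hb => hL.prop.mul_mem a b hb
    -- The idempotent `w` fixing `x` equals `u`, whatever `x` is.
    have : u = 1 := by
      refine DFunLike.ext _ _ fun x => ?_
      obtain ⟨w, hwL, hww, hwx⟩ := exists_idempotent_apply_eq hc hL.prop (hpap x)
      obtain ⟨r, hr, hur, hwr⟩ := exists_common_fixed_of_isAmenable hamen hc hL.prop huu hww
      rw [hL.idempotent_eq_of_mul_eq huL huu hwL hr hur hwr, hwx, one_apply]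
    exact this ▸ huL
  have hpL : p ∈ L := by simpa using hL.prop.mul_mem p 1 hone
  have h1 := hone
  rw [← hL.image_mul_right_eq hpL] at h1
  obtain ⟨q, -, hq⟩ := h1
  exact ⟨q, hq⟩

/-- If the enveloping semigroup is a group of continuous maps, its elements can be uniformly
approximated by finitely many elements of `T`. -/
theorem exists_finite_uniform_approx (hc : ∀ p : EnvelopingSemigroup T X, Continuous p)
    (hinv : ∀ p : EnvelopingSemigroup T X, ∃ q, q * p = 1) {ε : Set (X × X)}
    (hε : ε ∈ uniformity X) :
    ∃ K : Set T, K.Finite ∧ ∀ p : EnvelopingSemigroup T X, ∃ k ∈ K, ∀ x, (p x, k • x) ∈ ε := by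
  have := separatelyContinuousMul hc
  have htb : ∀ f : C(X, ℝ), TotallyBounded
      (Set.range fun p : EnvelopingSemigroup T X => f.comp ⟨p, hc p⟩) := fun f =>
    totallyBounded_range_of_dist_mul_right_le hinv _
      (fun x => f.continuous.comp (continuous_eval x)) fun p q r => by
        rw [ContinuousMap.dist_le dist_nonneg]
        exact fun x => ContinuousMap.dist_apply_le_dist (f := f.comp ⟨p, hc p⟩)
          (g := f.comp ⟨q, hc q⟩) (r x)
  -- A closed entourage lets the approximation pass from `T` to its closure.
  obtain ⟨δ, ⟨hδ, hδc⟩, hδε⟩ := (uniformity_hasBasis_closed (α := X)).mem_iff.1 hε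
  obtain ⟨K, hK, hKT⟩ : ∃ K : Set T, K.Finite ∧ ∀ t : T, ∃ k ∈ K, ∀ x : X,
      (t • x, k • x) ∈ δ := by
    -- `T` carries the uniformity of uniform convergence on `X`; its total boundedness is tested on
    -- one real function at a time.
    let : UniformSpace T := UniformSpace.comap
      (fun t : T => UniformFun.ofFun fun x : X => t • x) inferInstance
    have huni : TotallyBounded (Set.univ : Set T) := by
      refine totallyBounded_iff_ultrafilter.2 fun V _ => ⟨V.neBot, ?_⟩
      refine Tendsto.le_comap ((UniformFun.hasBasis_uniformity X X).tendsto_right_iff.2 ?_)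
      intro η hη
      have hten : Tendsto (fun z : (T × T) × X => (z.1.1 • z.2, z.1.2 • z.2))
          (((V : Filter T) ×ˢ (V : Filter T)) ×ˢ ⊤) (uniformity X) := by
        refine tendsto_uniformity_iff_continuousMap.2 fun f => ?_
        have hV := (totallyBounded_iff_ultrafilter.1 (htb f)
          (V.map fun t => f.comp ⟨of T X t, hc (of T X t)⟩)
          (le_principal_iff.2 (Ultrafilter.mem_map.2
            (Filter.univ_mem' fun t => ⟨of T X t, rfl⟩)))).2
        rw [Ultrafilter.coe_map, prod_map_map_eq] at hV
        rw [Metric.uniformity_basis_dist.tendsto_right_iff]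
        intro r hr
        have := hV (Metric.dist_mem_uniformity hr)
        have hev : ∀ᶠ z : T × T in (V : Filter T) ×ˢ (V : Filter T), ∀ x : X,
            dist (f (z.1 • x)) (f (z.2 • x)) < r := by
          filter_upwards [this] with z hz x
          exact (ContinuousMap.dist_apply_le_dist
            (f := f.comp ⟨of T X z.1, hc (of T X z.1)⟩)
            (g := f.comp ⟨of T X z.2, hc (of T X z.2)⟩) x).trans_lt hz
        exact (hev.prod_inl ⊤).mono fun z hz => hz z.2
      have := hten.eventually hη
      rw [Filter.eventually_iff, mem_prod_top] at this
      exact this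
    obtain ⟨K, hK, hKcov⟩ := huni _ (preimage_mem_comap
      ((UniformFun.hasBasis_uniformity X X).mem_of_mem hδ))
    refine ⟨K, hK, fun t => ?_⟩
    obtain ⟨k, hk, h⟩ := Set.mem_iUnion₂.1 (hKcov (Set.mem_univ t))
    exact ⟨k, hk, h⟩
  refine ⟨K, hK, fun p => ?_⟩
  have hclosed : IsClosed (⋃ k ∈ K, {p : EnvelopingSemigroup T X | ∀ x, (p x, k • x) ∈ δ}) := by
    refine hK.isClosed_biUnion fun k _ => ?_
    simp only [Set.ofPred_forall]
    exact isClosed_iInter fun x => hδc.preimage ((continuous_eval x).prodMk continuous_const)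
  have := denseRange_of.induction_on (p := fun p => p ∈ ⋃ k ∈ K,
    {p : EnvelopingSemigroup T X | ∀ x, (p x, k • x) ∈ δ}) p hclosed fun t => by
      obtain ⟨k, hk, h⟩ := hKT t
      exact Set.mem_iUnion₂.2 ⟨k, hk, h⟩
  obtain ⟨k, hk, h⟩ := Set.mem_iUnion₂.1 this
  exact ⟨k, hk, fun x => hδε (h x)⟩

end EnvelopingSemigroup

end Semiflow

/-! ### The main theorem -/

open Semiflow EnvelopingSemigroup in
theorem mainTheorem12
    {T : Type u} [Monoid T] [TopologicalSpace T] [ContinuousMul T]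
    {X : Type v} [UniformSpace X] [CompactSpace X] [T2Space X]
    [MulAction T X] [ContinuousSMul T X]
    (hamen : Semiflow.IsAmenable.{u, v} T)
    (hC : Semiflow.IsRightCSemigroup T)
    (hpap : Semiflow.IsPointwiseAlmostPeriodic T X)
    (hwap : Semiflow.IsWeaklyAlmostPeriodic T X) :
    Semiflow.IsUniformlyAlmostPeriodic T X := by
  have hc := continuous_of_isWeaklyAlmostPeriodic hwap
  have hinv := exists_left_inverse hamen hc hpap
  intro ε hε
  obtain ⟨K, hK, hKε⟩ := exists_finite_uniform_approx hc hinv hε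
  refine ⟨{t | ∀ x : X, (x, t • x) ∈ ε}, ⟨K, hK.isCompact, fun t => ?_⟩, fun x t ht => ht x⟩
  -- With `k` close to the inverse `q` of `t`, evaluating at `t • x` shows that `k * t` is close to
  -- the identity.
  obtain ⟨q, hq⟩ := hinv (of T X t)
  obtain ⟨k, hk, h⟩ := hKε q
  refine ⟨k, hk, fun x => ?_⟩
  have hqx : q (t • x) = x := DFunLike.congr_fun hq x
  have := h (t • x)
  rwa [hqx, ← mul_smul] at this
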